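/- Let $n\ge 2$ and let $D\subset\mathbb{C}^n$ be a bounded domain (nonempty connected open set) that is smoothly bounded: there are an open neighborhood $V$ of the boundary $bD$ and a real function $\rho\in C^\infty(V)$ with $d\rho\neq 0$ on $bD$ and $D\cap V=\{x\in V:\rho(x)<0\}$. Let $X=bD$, equipped with the induced CR structure $T_{0,1}X=T_{0,1}\mathbb{C}^n\cap(\mathbb{C}\otimes TX)$, and let $\mu$ be any smooth positive measure on $X$, i.e. a Borel measure with a smooth positive density with respect to Lebesgue measure in local coordinates. For a smooth complex vector field $Z$ on $X$ let $Z^\dagger$ be its formal adjoint with respect to $\mu$, defined by $\int_X g\,Z^\dagger\varphi\,d\mu=\int_X\varphi\,Zg\,d\mu$ for all $g,\varphi\in C^\infty(X)$. Let $\mathrm{CR}^2(X,\mu)$ be the closed subspace of those $f\in L^2(X,\mu)$ with $\int_X f\,Z^\dagger\varphi\,d\mu=0$ for all smooth sections $Z$ of $T_{0,1}X$ and all $\varphi\in C^\infty(X)$, and let $\mathcal{S}_{X,\mu}$ (the Szegő projection) be the orthogonal projection of $L^2(X,\mu)$ onto $\mathrm{CR}^2(X,\mu)$. Then $\mathcal{S}_{X,\mu}$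 is unbounded on $L^1$: there is no finite constant $C$ such that $$\|\mathcal{S}_{X,\mu}f\|_{L^1(X,\mu)}\le C\,\|f\|_{L^1(X,\mu)}\qquad\text{for all } f\in L^2(X,\mu)\cap L^1(X,\mu).$$ -/

import Mathlib

open MeasureTheory
open scoped ContDiff ENNReal NNReal Topology

noncomputable section

namespace Szego

/-- A domain in `ℂⁿ` (a nonempty connected open set) that is smoothly bounded: some real
function `ρ`, smooth on an open neighbourhood `V` of the boundary, satisfies `dρ ≠ 0` on the
boundary and `D ∩ V = {ρ < 0}`. -/
structure IsSmoothlyBoundedDomain {n : ℕ} (D : Set (EuclideanSpace ℂ (Fin n))) : Prop where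
  isOpen : IsOpen D
  isConnected : IsConnected D
  exists_defining : ∃ (V : Set (EuclideanSpace ℂ (Fin n))) (ρ : EuclideanSpace ℂ (Fin n) → ℝ),
    IsOpen V ∧ frontier D ⊆ V ∧ ContDiffOn ℝ ∞ ρ V ∧
    (∀ x ∈ frontier D, fderiv ℝ ρ x ≠ 0) ∧ D ∩ V = {x ∈ V | ρ x < 0}

/-- A smooth chart of the real hypersurface `X ⊆ ℂⁿ`: a homeomorphism `e` from an open subset of
`X` onto an open subset of `ℝ^(2n-1)` whose inverse, as a map into `ℂⁿ`, is a smooth immersion. -/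
structure IsSmoothChart {n : ℕ} (X : Set (EuclideanSpace ℂ (Fin n)))
    (e : OpenPartialHomeomorph X (EuclideanSpace ℝ (Fin (2 * n - 1)))) : Prop where
  contDiffOn : ContDiffOn ℝ ∞ (fun y => (e.symm y : EuclideanSpace ℂ (Fin n))) e.target
  injective : ∀ y ∈ e.target,
    Function.Injective (fderiv ℝ (fun y => (e.symm y : EuclideanSpace ℂ (Fin n))) y)

/-- A smooth positive measure on the hypersurface `X`: around every point there are local
coordinates in which `μ` has a smooth positive density with respect to Lebesgue measure. -/
class IsSmoothPositiveMeasure {n : ℕ} (X : Set (EuclideanSpace ℂ (Fin n)))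
    (μ : Measure X) : Prop where
  exists_density : ∀ x : X,
    ∃ (e : OpenPartialHomeomorph X (EuclideanSpace ℝ (Fin (2 * n - 1))))
      (w : EuclideanSpace ℝ (Fin (2 * n - 1)) → ℝ),
      IsSmoothChart X e ∧ x ∈ e.source ∧ ContDiffOn ℝ ∞ w e.target ∧ (∀ y ∈ e.target, 0 < w y) ∧
      (μ.restrict e.source).map e =
        (volume.restrict e.target).withDensity (fun y => ENNReal.ofReal (w y))

instance {n : ℕ} (X : Set (EuclideanSpace ℂ (Fin n))) (μ : Measure X)
    [h : IsSmoothPositiveMeasure X μ] : IsLocallyFiniteMeasure μ where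
  finiteAtNhds x := by
    obtain ⟨e, w, -, hx, hw, -, hμ⟩ := h.exists_density x
    obtain ⟨K, hK, hKt, hKc⟩ := local_compact_nhds (e.open_target.mem_nhds (e.map_source hx))
    refine ⟨e.source ∩ e ⁻¹' K, Filter.inter_mem (e.open_source.mem_nhds hx)
      ((e.continuousAt hx).preimage_mem_nhds hK), ?_⟩
    have he : AEMeasurable e (μ.restrict e.source) :=
      e.continuousOn.aemeasurable e.open_source.measurableSet
    have h1 : μ (e.source ∩ e ⁻¹' K) = (μ.restrict e.source).map e K := by
      rw [Measure.map_apply_of_aemeasurable he hKc.measurableSet,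
        Measure.restrict_apply' e.open_source.measurableSet, Set.inter_comm]
    rw [h1, hμ, withDensity_apply _ hKc.measurableSet,
      Measure.restrict_restrict hKc.measurableSet, Set.inter_eq_self_of_subset_left hKt]
    exact ((hw.continuousOn.mono hKt).integrableOn_compact hKc).lintegral_lt_top

/-- The tangent vectors of `X` at `x`: velocities of smooth curves in `X` through `x`. -/
def tangentVectors {n : ℕ} (X : Set (EuclideanSpace ℂ (Fin n))) (x : EuclideanSpace ℂ (Fin n)) :
    Set (EuclideanSpace ℂ (Fin n)) :=
  {v | ∃ γ : ℝ → EuclideanSpace ℂ (Fin n), γ 0 = x ∧ (∀ᶠ t in 𝓝 (0 : ℝ), γ t ∈ X) ∧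
    ContDiffAt ℝ ∞ γ 0 ∧ deriv γ 0 = v}

/-- A smooth complex vector field `re + i im` along a subset of `ℂⁿ`, that is, a section of the
complexification of the real tangent bundle of `ℂⁿ`; `re` and `im` are real vector fields. -/
structure ComplexVectorField (n : ℕ) where
  re : EuclideanSpace ℂ (Fin n) → EuclideanSpace ℂ (Fin n)
  im : EuclideanSpace ℂ (Fin n) → EuclideanSpace ℂ (Fin n)
  contDiff_re : ContDiff ℝ ∞ re
  contDiff_im : ContDiff ℝ ∞ im

/-- The action of a complex vector field on a function: `Z g = dg(re) + i dg(im)`. -/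
def ComplexVectorField.apply {n : ℕ} (Z : ComplexVectorField n)
    (g : EuclideanSpace ℂ (Fin n) → ℂ) (x : EuclideanSpace ℂ (Fin n)) : ℂ :=
  fderiv ℝ g x (Z.re x) + Complex.I * fderiv ℝ g x (Z.im x)

/-- `Z` restricts to a section over `X` of `T_{0,1}X = T_{0,1}ℂⁿ ∩ ℂTX`. A complex tangent vector
`a + i b` of `ℂⁿ` is of type `(0,1)`, i.e. a combination of the
`∂/∂z̄_j = (∂/∂x_j + i ∂/∂y_j) / 2`, exactly when `b = J a`, where `J` is multiplication by `i`;
it lies in `ℂTX` when `a` and `b` are tangent to `X`. -/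
def ComplexVectorField.IsSectionT01 {n : ℕ} (X : Set (EuclideanSpace ℂ (Fin n)))
    (Z : ComplexVectorField n) : Prop :=
  ∀ x ∈ X, Z.re x ∈ tangentVectors X x ∧ Z.im x ∈ tangentVectors X x ∧
    Z.im x = Complex.I • Z.re x

/-- The restriction of `φ` to `X` is a test function. Smooth functions on the closed
hypersurface `X` are represented by smooth functions on `ℂⁿ`. -/
def IsTestFunction {n : ℕ} (X : Set (EuclideanSpace ℂ (Fin n)))
    (φ : EuclideanSpace ℂ (Fin n) → ℂ) : Prop :=
  ContDiff ℝ ∞ φ ∧ HasCompactSupport (fun x : X => φ x)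

/-- `ψ = Z† φ` on `X`, where `Z†` is the formal adjoint (transpose) of `Z` with respect to `μ`:
`∫ g Z†φ dμ = ∫ φ Zg dμ` for every smooth `g`. -/
def IsFormalAdjoint {n : ℕ} {X : Set (EuclideanSpace ℂ (Fin n))} (μ : Measure X)
    (Z : ComplexVectorField n) (φ ψ : EuclideanSpace ℂ (Fin n) → ℂ) : Prop :=
  ∀ g : EuclideanSpace ℂ (Fin n) → ℂ, ContDiff ℝ ∞ g →
    ∫ x : X, g x * ψ x ∂μ = ∫ x : X, φ x * Z.apply g x ∂μ

/-- `f` is annihilated by all sections of `T_{0,1}X` in the sense of distributions: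
`∫ f Z†φ dμ = 0` for every smooth section `Z` of `T_{0,1}X` and every test function `φ`. -/
def IsCR {n : ℕ} {X : Set (EuclideanSpace ℂ (Fin n))} (μ : Measure X) (f : X → ℂ) : Prop :=
  ∀ Z : ComplexVectorField n, Z.IsSectionT01 X →
    ∀ φ ψ : EuclideanSpace ℂ (Fin n) → ℂ, IsTestFunction X φ → IsTestFunction X ψ →
      IsFormalAdjoint μ Z φ ψ → ∫ x : X, f x * ψ x ∂μ = 0

lemma IsTestFunction.memLp {n : ℕ} {X : Set (EuclideanSpace ℂ (Fin n))} (μ : Measure X)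
    [IsLocallyFiniteMeasure μ] {ψ : EuclideanSpace ℂ (Fin n) → ℂ} (h : IsTestFunction X ψ) :
    MemLp (fun x : X => ψ x) 2 μ :=
  (h.1.continuous.comp continuous_subtype_val).memLp_of_hasCompactSupport h.2

lemma integrable_mul_test {n : ℕ} {X : Set (EuclideanSpace ℂ (Fin n))} (μ : Measure X)
    [IsLocallyFiniteMeasure μ] {ψ : EuclideanSpace ℂ (Fin n) → ℂ} (h : IsTestFunction X ψ)
    (f : Lp ℂ 2 μ) : Integrable (fun x : X => f x * ψ x) μ :=
  (Lp.memLp f).integrable_mul (h.memLp μ)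

/-- The space of square-integrable CR functions on `X`. -/
def CR2 {n : ℕ} {X : Set (EuclideanSpace ℂ (Fin n))} (μ : Measure X)
    [IsLocallyFiniteMeasure μ] : Submodule ℂ (Lp ℂ 2 μ) where
  carrier := {f | IsCR μ f}
  zero_mem' := by
    intro Z _ φ ψ _ _ _
    have : (fun x : X => (0 : Lp ℂ 2 μ) x * ψ x) =ᵐ[μ] fun _ => 0 := by
      filter_upwards [Lp.coeFn_zero ℂ 2 μ] with x hx
      rw [hx, Pi.zero_apply, zero_mul]
    rw [integral_congr_ae this, integral_zero]
  add_mem' := by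
    intro f g hf hg Z hZ φ ψ hφ hψ h
    have : (fun x : X => (f + g) x * ψ x) =ᵐ[μ] fun x => f x * ψ x + g x * ψ x := by
      filter_upwards [Lp.coeFn_add f g] with x hx
      rw [hx, Pi.add_apply, add_mul]
    rw [integral_congr_ae this, integral_add (integrable_mul_test μ hψ f)
      (integrable_mul_test μ hψ g), hf Z hZ φ ψ hφ hψ h, hg Z hZ φ ψ hφ hψ h, add_zero]
  smul_mem' := by
    intro c f hf Z hZ φ ψ hφ hψ h
    have : (fun x : X => (c • f) x * ψ x) =ᵐ[μ] fun x => c * (f x * ψ x) := by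
      filter_upwards [Lp.coeFn_smul c f] with x hx
      simp [hx, mul_assoc]
    rw [integral_congr_ae this, integral_const_mul, hf Z hZ φ ψ hφ hψ h, mul_zero]

lemma isClosed_CR2 {n : ℕ} {X : Set (EuclideanSpace ℂ (Fin n))} (μ : Measure X)
    [IsLocallyFiniteMeasure μ] : IsClosed (CR2 μ : Set (Lp ℂ 2 μ)) := by
  have key : ∀ ψ : EuclideanSpace ℂ (Fin n) → ℂ, IsTestFunction X ψ →
      IsClosed {f : Lp ℂ 2 μ | ∫ x : X, f x * ψ x ∂μ = 0} := by
    intro ψ hψ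
    have hs : {f : Lp ℂ 2 μ | ∫ x : X, f x * ψ x ∂μ = 0} =
        {f : Lp ℂ 2 μ | inner ℂ ((hψ.memLp μ).star.toLp) f = 0} := by
      ext f
      have : (fun x : X => f x * ψ x) =ᵐ[μ]
          fun x => inner ℂ (((hψ.memLp μ).star.toLp : Lp ℂ 2 μ) x) (f x) := by
        filter_upwards [(hψ.memLp μ).star.coeFn_toLp] with x hx
        simp [hx]
      simp only [Set.mem_ofPred_eq, L2.inner_def, integral_congr_ae this]
    rw [hs]
    exact isClosed_eq (continuous_const.inner continuous_id) continuous_const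
  have : (CR2 μ : Set (Lp ℂ 2 μ)) = ⋂ (Z : ComplexVectorField n) (_ : Z.IsSectionT01 X)
      (φ : EuclideanSpace ℂ (Fin n) → ℂ) (ψ : EuclideanSpace ℂ (Fin n) → ℂ)
      (_ : IsTestFunction X φ) (_ : IsTestFunction X ψ) (_ : IsFormalAdjoint μ Z φ ψ),
      {f : Lp ℂ 2 μ | ∫ x : X, f x * ψ x ∂μ = 0} := by
    ext f
    simp only [Set.mem_iInter]
    rfl
  rw [this]
  exact isClosed_iInter fun Z => isClosed_iInter fun _ => isClosed_iInter fun φ =>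
    isClosed_iInter fun ψ => isClosed_iInter fun _ => isClosed_iInter fun hψ =>
    isClosed_iInter fun _ => key ψ hψ

instance {n : ℕ} {X : Set (EuclideanSpace ℂ (Fin n))} (μ : Measure X)
    [IsLocallyFiniteMeasure μ] : CompleteSpace (CR2 μ) :=
  (isClosed_CR2 μ).completeSpace_coe

/-- The Szegő projection: the orthogonal projection of `L²(X, μ)` onto the CR functions. -/
def szegoProjection {n : ℕ} {X : Set (EuclideanSpace ℂ (Fin n))} (μ : Measure X)
    [IsLocallyFiniteMeasure μ] : Lp ℂ 2 μ →L[ℂ] Lp ℂ 2 μ :=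
  (CR2 μ).starProjection

/-- `‖T f‖_{L¹} ≤ C ‖f‖_{L¹}` for all `f ∈ L² ∩ L¹`, with a finite constant `C`. -/
def IsBoundedOnL1 {α : Type*} [MeasurableSpace α] {μ : Measure α}
    (T : Lp ℂ 2 μ →L[ℂ] Lp ℂ 2 μ) : Prop :=
  ∃ C : ℝ≥0, ∀ f : Lp ℂ 2 μ, MemLp f 1 μ → eLpNorm (T f) 1 μ ≤ C * eLpNorm f 1 μ

end Szego

end

/-! Work with the transpose `Sᵗ` of the projection `S` for the bilinear pairing `∫ f g dμ`. Two
families of functions have explicit images. If `H` is entire, its restriction to `X` is CR, so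
self-adjointness gives `Sᵗ(conj H) = conj H`. Every `Z†φ` pairs to zero with CR functions, so
`Sᵗ(Z†φ) = 0`. An `L¹` bound for `S` would be a sup-norm bound for `Sᵗ`, and these families rule
that out.

A point `p` of `X` farthest from a point of `D` is a peak point of a polynomial `h`
(`exists_peak_function`), and since `n ≥ 2` some section `Z` of `T_{0,1}X` is nonzero at `p`. Near
`p`, `Z†` is `-Z` plus a smooth multiplier (`exists_section_formalAdjoint`). Rescaling
(`exists_scaled_linear`) then gives `ψ = Z†φ` with support in an arbitrarily small ball, fixed
nonzero value `κ` at `p`, and a bound independent of the ball. The function `g = conj(h^N) - ψ/κ`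
vanishes at `p`, is uniformly bounded and is small off any prescribed neighbourhood, while `A = Sᵗ g
= conj(h^N)` equals 1 at `p`.

Adding `J` such functions, each concentrated where the previous sum is small, keeps the sup norm
bounded while the image takes the value `J` at `p` (`exists_isTransposePair_nat`). Pairing with the
indicator of a small neighbourhood of `p` contradicts an `L¹` bound (`not_isBoundedOnL1`). No
pseudoconvexity is needed. -/

namespace Szego

/-! ### Divergence theorem and local left inverses of immersions -/

section Divergence

/-- A smooth function on an open set that vanishes off a closed subset extends by zero. -/
lemma contDiff_indicator {E F : Type*} [NormedAddCommGroup E] [NormedSpace ℝ E]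
    [NormedAddCommGroup F] [NormedSpace ℝ F] {O K : Set E} {f : E → F} (hO : IsOpen O)
    (hK : IsClosed K) (hKO : K ⊆ O) (hf : ContDiffOn ℝ ∞ f O) (h0 : ∀ x ∈ O, x ∉ K → f x = 0) :
    ContDiff ℝ ∞ (O.indicator f) := by
  refine contDiff_iff_contDiffAt.2 fun x => ?_
  by_cases hx : x ∈ O
  · refine (hf.contDiffAt (hO.mem_nhds hx)).congr_of_eventuallyEq ?_
    filter_upwards [hO.mem_nhds hx] with y hy using Set.indicator_of_mem hy f
  · refine (contDiffAt_const (c := (0 : F))).congr_of_eventuallyEq ?_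
    filter_upwards [hK.isOpen_compl.mem_nhds fun h => hx (hKO h)] with y hy
    by_cases hyO : y ∈ O
    · rw [Set.indicator_of_mem hyO, h0 y hyO hy]
    · exact Set.indicator_of_notMem hyO f

lemma integral_fderiv_eq_zero {E : Type*} [NormedAddCommGroup E] [NormedSpace ℝ E]
    [FiniteDimensional ℝ E] [MeasurableSpace E] [BorelSpace E] (μ : Measure E)
    [μ.IsAddHaarMeasure] {f : E → ℂ} (hf : ContDiff ℝ 1 f) (hc : HasCompactSupport f) (v : E) :
    ∫ x, fderiv ℝ f x v ∂μ = 0 := by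
  have hi : Integrable (fun x => fderiv ℝ f x v) μ :=
    ((hf.continuous_fderiv one_ne_zero).clm_apply continuous_const).integrable_of_hasCompactSupport
      ((hc.fderiv ℝ).comp_left (g := fun L : E →L[ℝ] ℂ => L v) rfl)
  have := integral_mul_fderiv_eq_neg_fderiv_mul_of_integrable (μ := μ) (f := fun _ => (1 : ℂ))
    (g := f) (v := v) (by simp) (by simpa using hi)
    (by simpa using hf.continuous.integrable_of_hasCompactSupport hc)
    (fun x _ => differentiableAt_const _) fun x _ => hf.differentiable one_ne_zero x
  simpa using this

/-- The divergence of a vector field on `ℝᵐ`. -/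
noncomputable def euclideanDiv {m : ℕ} (v : EuclideanSpace ℝ (Fin m) → EuclideanSpace ℝ (Fin m))
    (y : EuclideanSpace ℝ (Fin m)) : ℝ :=
  ∑ i, fderiv ℝ v y (EuclideanSpace.single i 1) i

lemma contDiffOn_euclideanDiv {m : ℕ} {O : Set (EuclideanSpace ℝ (Fin m))} (hO : IsOpen O)
    {v : EuclideanSpace ℝ (Fin m) → EuclideanSpace ℝ (Fin m)} (hv : ContDiffOn ℝ ∞ v O) :
    ContDiffOn ℝ ∞ (euclideanDiv v) O := by
  unfold euclideanDiv
  refine ContDiffOn.sum fun i _ => ?_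
  have h1 : ContDiffOn ℝ ∞ (fun y => fderiv ℝ v y (EuclideanSpace.single i 1)) O :=
    (hv.fderiv_of_isOpen hO (by simp)).clm_apply contDiffOn_const
  exact (EuclideanSpace.proj (𝕜 := ℝ) i).contDiff.comp_contDiffOn h1

/-- The divergence theorem for compactly supported functions. -/
lemma integral_fderiv_add_div_eq_zero {m : ℕ} {O K : Set (EuclideanSpace ℝ (Fin m))}
    (hO : IsOpen O) (hK : IsCompact K) (hKO : K ⊆ O) {F : EuclideanSpace ℝ (Fin m) → ℂ}
    {v : EuclideanSpace ℝ (Fin m) → EuclideanSpace ℝ (Fin m)} (hF : ContDiffOn ℝ ∞ F O)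
    (hv : ContDiffOn ℝ ∞ v O) (hF0 : ∀ y ∈ O, y ∉ K → F y = 0) :
    ∫ y in O, (fderiv ℝ F y (v y) + (euclideanDiv v y : ℂ) * F y) = 0 := by
  have hvi (i : Fin m) : ContDiffOn ℝ ∞ (fun y => v y i) O :=
    (EuclideanSpace.proj (𝕜 := ℝ) i).contDiff.comp_contDiffOn hv
  let P (i : Fin m) : EuclideanSpace ℝ (Fin m) → ℂ := O.indicator fun y => v y i • F y
  have hP (i : Fin m) : ContDiff ℝ ∞ (P i) :=
    contDiff_indicator hO hK.isClosed hKO ((hvi i).smul hF) fun y hy hyK => by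
      simp [hF0 y hy hyK]
  have hPc (i : Fin m) : HasCompactSupport (P i) := by
    refine HasCompactSupport.intro hK fun y hy => ?_
    by_cases hyO : y ∈ O
    · simp [P, hyO, hF0 y hyO hy]
    · simp [P, hyO]
  have hPi (i : Fin m) : ∀ y ∉ O, fderiv ℝ (P i) y (EuclideanSpace.single i 1) = 0 := by
    intro y hy
    have : P i =ᶠ[𝓝 y] fun _ => 0 := by
      filter_upwards [hK.isClosed.isOpen_compl.mem_nhds fun h => hy (hKO h)] with z hz
      by_cases hzO : z ∈ O
      · simp [P, hzO, hF0 z hzO hz]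
      · simp [P, hzO]
    simp [this.fderiv_eq]
  have hsum : ∀ y ∈ O, fderiv ℝ F y (v y) + (euclideanDiv v y : ℂ) * F y =
      ∑ i, fderiv ℝ (P i) y (EuclideanSpace.single i 1) := by
    intro y hy
    have hdF : DifferentiableAt ℝ F y :=
      (hF.contDiffAt (hO.mem_nhds hy)).differentiableAt (by simp)
    have hdv : DifferentiableAt ℝ v y :=
      (hv.contDiffAt (hO.mem_nhds hy)).differentiableAt (by simp)
    have h1 (i : Fin m) : fderiv ℝ (P i) y (EuclideanSpace.single i 1) =
        v y i • fderiv ℝ F y (EuclideanSpace.single i 1) +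
          (fderiv ℝ v y (EuclideanSpace.single i 1) i) • F y := by
      have he : P i =ᶠ[𝓝 y] fun y => v y i • F y := by
        filter_upwards [hO.mem_nhds hy] with z hz using Set.indicator_of_mem hz _
      have hvi' : HasFDerivAt (fun y => v y i)
          ((EuclideanSpace.proj (𝕜 := ℝ) i).comp (fderiv ℝ v y)) y :=
        (EuclideanSpace.proj (𝕜 := ℝ) i).hasFDerivAt.comp y hdv.hasFDerivAt
      rw [he.fderiv_eq, (hvi'.fun_smul hdF.hasFDerivAt).fderiv]
      simp
    have h2 : v y = ∑ i, v y i • EuclideanSpace.single i (1 : ℝ) := by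
      ext j
      simp [Finset.sum_apply, Pi.single_apply]
    simp only [h1, Finset.sum_add_distrib]
    congr 1
    · conv_lhs => rw [h2]
      simp [map_sum]
    · simp [euclideanDiv, Finset.sum_mul]
  rw [setIntegral_congr_fun hO.measurableSet hsum, setIntegral_eq_integral_of_forall_compl_eq_zero
    (fun y hy => Finset.sum_eq_zero fun i _ => hPi i y hy), integral_finsetSum]
  · exact Finset.sum_eq_zero fun i _ =>
      integral_fderiv_eq_zero volume ((hP i).of_le (by simp)) (hPc i) _
  · intro i _
    exact (((hP i).continuous_fderiv (by simp)).clm_apply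
      continuous_const).integrable_of_hasCompactSupport (((hPc i).fderiv ℝ).comp_left
        (g := fun L : EuclideanSpace ℝ (Fin m) →L[ℝ] ℂ => L (EuclideanSpace.single i 1)) rfl)

/-- A smooth immersion has a smooth left inverse near every point. -/
lemma exists_smooth_leftInverse {E F : Type*} [NormedAddCommGroup E] [NormedSpace ℝ E]
    [FiniteDimensional ℝ E] [NormedAddCommGroup F] [NormedSpace ℝ F] [FiniteDimensional ℝ F]
    {O : Set F} {s : F → E} (hO : IsOpen O) (hs : ContDiffOn ℝ ∞ s O) {y₀ : F} (hy₀ : y₀ ∈ O)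
    (hinj : Function.Injective (fderiv ℝ s y₀)) :
    ∃ (π : E → F) (W : Set E) (O' : Set F), IsOpen W ∧ ContDiffOn ℝ ∞ π W ∧ IsOpen O' ∧
      y₀ ∈ O' ∧ O' ⊆ O ∧ ∀ y ∈ O', s y ∈ W ∧ π (s y) = y := by
  obtain ⟨L, hL⟩ := (fderiv ℝ s y₀ : F →ₗ[ℝ] E).exists_leftInverse_of_injective
    (LinearMap.ker_eq_bot.2 hinj)
  let L' : E →L[ℝ] F := LinearMap.toContinuousLinearMap L
  have hsd : ∀ y ∈ O, HasFDerivAt s (fderiv ℝ s y) y := fun y hy =>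
    ((hs.contDiffAt (hO.mem_nhds hy)).differentiableAt (by simp)).hasFDerivAt
  have hLs : ContDiffOn ℝ ∞ (fun y => L' (s y)) O := L'.contDiff.comp_contDiffOn hs
  have hd : ∀ y ∈ O, HasFDerivAt (fun y => L' (s y)) (L'.comp (fderiv ℝ s y)) y := fun y hy =>
    L'.hasFDerivAt.comp y (hsd y hy)
  have h0 : L'.comp (fderiv ℝ s y₀) = (ContinuousLinearEquiv.refl ℝ F : F →L[ℝ] F) := by
    ext y
    exact LinearMap.congr_fun hL y
  have hd0 : HasFDerivAt (fun y => L' (s y)) (ContinuousLinearEquiv.refl ℝ F : F →L[ℝ] F) y₀ :=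
    h0 ▸ hd y₀ hy₀
  -- Inverse function theorem for `L' ∘ s`, whose derivative at `y₀` is the identity; the left
  -- inverse is `τ.symm ∘ L'`.
  let τ := (hLs.contDiffAt (hO.mem_nhds hy₀)).toOpenPartialHomeomorph _ hd0 (by simp)
  have hτ : ∀ y, τ y = L' (s y) := fun y => rfl
  -- Smoothness of `τ.symm` is available only where the derivative of `L' ∘ s` is invertible, an
  -- open condition.
  let Q : Set F := O ∩ (fun y => L'.comp (fderiv ℝ s y)) ⁻¹'
    Set.range ((↑) : (F ≃L[ℝ] F) → F →L[ℝ] F)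
  have hcont : ContinuousOn (fun y => L'.comp (fderiv ℝ s y)) O :=
    continuousOn_const.clm_comp (hs.continuousOn_fderiv_of_isOpen hO (by simp))
  have hQ : IsOpen Q := hcont.isOpen_inter_preimage hO ContinuousLinearEquiv.isOpen
  have hQ0 : y₀ ∈ Q := ⟨hy₀, ContinuousLinearEquiv.refl ℝ F, h0.symm⟩
  refine ⟨fun x => τ.symm (L' x), L' ⁻¹' (τ.target ∩ τ.symm ⁻¹' Q), τ.source ∩ Q,
    (τ.symm.isOpen_inter_preimage hQ).preimage L'.continuous, ?_, τ.open_source.inter hQ,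
    ⟨ContDiffAt.mem_toOpenPartialHomeomorph_source _ hd0 (by simp), hQ0⟩,
    fun y hy => hy.2.1, ?_⟩
  · have : ContDiffOn ℝ ∞ τ.symm (τ.target ∩ τ.symm ⁻¹' Q) := by
      rintro z ⟨hz, hzO, f', hf'⟩
      refine ContDiffAt.contDiffWithinAt (τ.contDiffAt_symm hz (f₀' := f') ?_ ?_)
      · rw [hf']
        exact hd _ hzO
      · exact hLs.contDiffAt (hO.mem_nhds hzO)
    exact this.comp L'.contDiff.contDiffOn fun x hx => hx
  · rintro y ⟨hy, hyQ⟩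
    have h1 : τ.symm (L' (s y)) = y := τ.left_inv hy
    refine ⟨⟨τ.map_source hy, ?_⟩, h1⟩
    change τ.symm (L' (s y)) ∈ Q
    rwa [h1]

end Divergence

/-! ### Integration by parts on the hypersurface -/

section Chart

variable {n : ℕ} {X : Set (EuclideanSpace ℂ (Fin n))}

lemma integral_eq_integral_chart {μ : Measure X}
    {e : OpenPartialHomeomorph X (EuclideanSpace ℝ (Fin (2 * n - 1)))}
    {w : EuclideanSpace ℝ (Fin (2 * n - 1)) → ℝ} (hw : ContDiffOn ℝ ∞ w e.target)
    (hw0 : ∀ y ∈ e.target, 0 < w y)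
    (hμ : (μ.restrict e.source).map e =
      (volume.restrict e.target).withDensity (fun y => ENNReal.ofReal (w y)))
    {O : Set (EuclideanSpace ℝ (Fin (2 * n - 1)))} (hOe : O ⊆ e.target)
    {Φ : X → ℂ} (hΦ : Continuous Φ) (h0 : ∀ x, x ∉ e.source ∩ e ⁻¹' O → Φ x = 0) :
    ∫ x, Φ x ∂μ = ∫ y in O, (w y : ℂ) * Φ (e.symm y) := by
  have he : AEMeasurable e (μ.restrict e.source) :=
    e.continuousOn.aemeasurable e.open_source.measurableSet
  have hwm : AEMeasurable w (volume.restrict e.target) :=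
    hw.continuousOn.aemeasurable e.open_target.measurableSet
  have hsm : AEStronglyMeasurable (fun y => Φ (e.symm y)) ((μ.restrict e.source).map e) := by
    rw [hμ]
    exact ((hΦ.comp_continuousOn e.continuousOn_symm).aestronglyMeasurable
      e.open_target.measurableSet).mono_ac (withDensity_absolutelyContinuous _ _)
  calc ∫ x, Φ x ∂μ = ∫ x in e.source, Φ x ∂μ :=
        (setIntegral_eq_integral_of_forall_compl_eq_zero fun x hx => h0 x fun h => hx h.1).symm
    _ = ∫ x in e.source, Φ (e.symm (e x)) ∂μ :=
        setIntegral_congr_fun e.open_source.measurableSet fun x hx => by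
          simp only [e.left_inv hx]
    _ = ∫ y, Φ (e.symm y) ∂((μ.restrict e.source).map e) := (integral_map he hsm).symm
    _ = ∫ y in e.target, (w y : ℂ) * Φ (e.symm y) := by
        rw [hμ]
        change ∫ y, Φ (e.symm y) ∂((volume.restrict e.target).withDensity
          fun y => ((w y).toNNReal : ℝ≥0∞)) = _
        rw [integral_withDensity_eq_integral_smul₀ hwm.real_toNNReal]
        refine setIntegral_congr_fun e.open_target.measurableSet fun y hy => ?_
        simp only [NNReal.smul_def, Real.coe_toNNReal _ (hw0 y hy).le, Complex.real_smul]
    _ = ∫ y in O, (w y : ℂ) * Φ (e.symm y) := by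
        refine (setIntegral_eq_of_subset_of_forall_sdiff_eq_zero e.open_target.measurableSet hOe
          fun y hy => ?_)
        rw [h0 _ fun h => hy.2 ?_, mul_zero]
        simpa only [Set.mem_preimage, e.right_inv hy.1] using h.2

/-- Integration by parts on `X` along a smooth tangent vector field, near a point. -/
lemma exists_integral_fderiv_eq (hX : IsCompact X) {μ : Measure X} [IsFiniteMeasure μ]
    {e : OpenPartialHomeomorph X (EuclideanSpace ℝ (Fin (2 * n - 1)))}
    (he : IsSmoothChart X e) {w : EuclideanSpace ℝ (Fin (2 * n - 1)) → ℝ}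
    (hw : ContDiffOn ℝ ∞ w e.target) (hw0 : ∀ y ∈ e.target, 0 < w y)
    (hμ : (μ.restrict e.source).map e =
      (volume.restrict e.target).withDensity (fun y => ENNReal.ofReal (w y)))
    {p : X} (hp : p ∈ e.source) {b : EuclideanSpace ℂ (Fin n) → EuclideanSpace ℂ (Fin n)}
    (hb : ContDiff ℝ ∞ b)
    (hbt : ∀ y ∈ e.target, ∃ u, fderiv ℝ (fun y => (e.symm y : EuclideanSpace ℂ (Fin n))) y u =
      b (e.symm y)) :
    ∃ (m : EuclideanSpace ℂ (Fin n) → ℂ) (r : ℝ), ContDiff ℝ ∞ m ∧ 0 < r ∧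
      ∀ f : EuclideanSpace ℂ (Fin n) → ℂ, ContDiff ℝ ∞ f →
        tsupport f ⊆ Metric.closedBall (p : EuclideanSpace ℂ (Fin n)) r →
        ∫ x : X, fderiv ℝ f x (b x) ∂μ = ∫ x : X, m x * f x ∂μ := by
  set s : EuclideanSpace ℝ (Fin (2 * n - 1)) → EuclideanSpace ℂ (Fin n) :=
    fun y => (e.symm y : EuclideanSpace ℂ (Fin n)) with hs_def
  have hs : ContDiffOn ℝ ∞ s e.target := he.contDiffOn
  obtain ⟨π, W, O, hW, hπ, hO, hyO, hOe, hOW⟩ := exists_smooth_leftInverse e.open_target hs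
    (e.map_source hp) (he.injective _ (e.map_source hp))
  have hsp : s (e p) = p := by simp only [hs_def, e.left_inv hp]
  -- The coordinate expression of the tangent field `b`, weighted by the density so that the
  -- integral becomes a Lebesgue one.
  let v : EuclideanSpace ℝ (Fin (2 * n - 1)) → EuclideanSpace ℝ (Fin (2 * n - 1)) :=
    fun y => w y • fderiv ℝ π (s y) (b (s y))
  have hsO : ContDiffOn ℝ ∞ s O := hs.mono hOe
  have hv : ContDiffOn ℝ ∞ v O := (hw.mono hOe).smul
    (((hπ.fderiv_of_isOpen hW (m := ∞) (by simp)).comp hsO fun y hy => (hOW y hy).1).clm_apply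
      (hb.comp_contDiffOn hsO))
  have hdv : ∀ y ∈ O, fderiv ℝ s y (v y) = w y • b (s y) := by
    intro y hy
    obtain ⟨u, hu⟩ := hbt y (hOe hy)
    have hsd : HasFDerivAt s (fderiv ℝ s y) y :=
      ((hsO.contDiffAt (hO.mem_nhds hy)).differentiableAt (by simp)).hasFDerivAt
    have hπd : HasFDerivAt π (fderiv ℝ π (s y)) (s y) :=
      ((hπ.contDiffAt (hW.mem_nhds (hOW y hy).1)).differentiableAt (by simp)).hasFDerivAt
    have hid : HasFDerivAt (fun z => π (s z)) (ContinuousLinearMap.id ℝ _) y := by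
      refine (hasFDerivAt_id y).congr_of_eventuallyEq ?_
      filter_upwards [hO.mem_nhds hy] with z hz using (hOW z hz).2
    have h1 := (hπd.comp y hsd).unique hid
    have h2 : fderiv ℝ π (s y) (b (s y)) = u := by
      rw [← hu]
      exact DFunLike.congr_fun h1 u
    simp only [v, h2, map_smul, hu]
    rfl
  -- Minus the `μ`-divergence of `b` in coordinates; `π` and a cutoff extend it to all of `ℂⁿ`.
  let m₀ : EuclideanSpace ℝ (Fin (2 * n - 1)) → ℂ :=
    fun y => Complex.ofRealCLM (-(euclideanDiv v y / w y))
  have hm₀ : ContDiffOn ℝ ∞ m₀ O := Complex.ofRealCLM.contDiff.comp_contDiffOn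
    (((contDiffOn_euclideanDiv hO hv).div (hw.mono hOe)
      fun y hy => (hw0 y (hOe hy)).ne').neg)
  have hW' : IsOpen (W ∩ π ⁻¹' O) := hπ.continuousOn.isOpen_inter_preimage hW hO
  have hpW : (p : EuclideanSpace ℂ (Fin n)) ∈ W ∩ π ⁻¹' O := by
    have := hOW _ hyO
    rw [hsp] at this
    exact ⟨this.1, by rw [Set.mem_preimage, this.2]; exact hyO⟩
  obtain ⟨r₁, hr₁, hr₁W⟩ := Metric.nhds_basis_closedBall.mem_iff.1 (hW'.mem_nhds hpW)
  have hsrc : IsOpen (e.source ∩ e ⁻¹' O) := e.isOpen_inter_preimage hO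
  obtain ⟨r₂, hr₂, hr₂W⟩ := Metric.nhds_basis_closedBall.mem_iff.1 (hsrc.mem_nhds ⟨hp, hyO⟩)
  -- The cutoff is 1 on the ball that will contain the support of `f`; `r₂` keeps that support,
  -- within `X`, inside the chart.
  let χ : ContDiffBump (p : EuclideanSpace ℂ (Fin n)) :=
    ⟨min (r₁ / 2) r₂, r₁, by positivity, (min_le_left _ _).trans_lt (by linarith)⟩
  let m : EuclideanSpace ℂ (Fin n) → ℂ := (W ∩ π ⁻¹' O).indicator fun x => χ x • m₀ (π x)
  have hm : ContDiff ℝ ∞ m := by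
    refine contDiff_indicator hW' (isClosed_tsupport χ) ?_ ?_ ?_
    · rw [χ.tsupport_eq]
      exact hr₁W
    · exact χ.contDiff.contDiffOn.smul
        (hm₀.comp (hπ.mono Set.inter_subset_left) fun x hx => hx.2)
    · intro x _ hx
      simp [image_eq_zero_of_notMem_tsupport hx]
  refine ⟨m, min (r₁ / 2) r₂, hm, by positivity, fun f hf hfs => ?_⟩
  have : CompactSpace X := isCompact_iff_compactSpace.1 hX
  have hfd : Continuous fun x => fderiv ℝ f x (b x) :=
    (hf.continuous_fderiv (by simp)).clm_apply hb.continuous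
  have hint : ∀ {g : EuclideanSpace ℂ (Fin n) → ℂ}, Continuous g →
      Integrable (fun x : X => g x) μ := fun hg =>
    (hg.comp continuous_subtype_val).integrable_of_hasCompactSupport
      (HasCompactSupport.of_compactSpace _)
  rw [← sub_eq_zero, ← integral_sub (hint hfd) 
    (hint (g := fun x => m x * f x) (hm.continuous.mul hf.continuous))]
  have hf0 : ∀ x ∉ Metric.closedBall (p : EuclideanSpace ℂ (Fin n)) (min (r₁ / 2) r₂),
      f x = 0 ∧ fderiv ℝ f x = 0 := fun x hx =>
    ⟨image_eq_zero_of_notMem_tsupport fun h => hx (hfs h),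
      image_eq_zero_of_notMem_tsupport fun h => hx (hfs (tsupport_fderiv_subset ℝ h))⟩
  rw [integral_eq_integral_chart hw hw0 hμ hOe
    (Φ := fun x : X => fderiv ℝ f x (b x) - m x * f x)
    ((hfd.sub (hm.continuous.mul hf.continuous)).comp continuous_subtype_val)]
  swap
  · intro x hx
    have := hf0 x fun h => hx (hr₂W (Metric.closedBall_subset_closedBall (min_le_right _ _) h))
    simp [this.1, this.2]
  have hK : IsCompact (e '' (Metric.closedBall p (min (r₁ / 2) r₂))) :=
    (Metric.isClosed_closedBall.isCompact).image_of_continuousOn (e.continuousOn.mono fun x hx =>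
      (hr₂W (Metric.closedBall_subset_closedBall (min_le_right _ _) hx)).1)
  rw [← integral_fderiv_add_div_eq_zero (F := fun y => f (s y)) hO hK ?_
    (hf.comp_contDiffOn hsO) hv ?_]
  · refine setIntegral_congr_fun hO.measurableSet fun y hy => ?_
    have hsd : HasFDerivAt s (fderiv ℝ s y) y :=
      ((hsO.contDiffAt (hO.mem_nhds hy)).differentiableAt (by simp)).hasFDerivAt
    have hfd : HasFDerivAt f (fderiv ℝ f (s y)) (s y) :=
      (hf.differentiable (by simp) _).hasFDerivAt
    have h1 : fderiv ℝ (fun y => f (s y)) y (v y) = w y • fderiv ℝ f (s y) (b (s y)) := by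
      rw [show fderiv ℝ (fun y => f (s y)) y = _ from (hfd.comp y hsd).fderiv, 
        ContinuousLinearMap.comp_apply, hdv y hy, map_smul]
    change (w y : ℂ) * (fderiv ℝ f (s y) (b (s y)) - m (s y) * f (s y)) =
      fderiv ℝ (fun y => f (s y)) y (v y) + (euclideanDiv v y : ℂ) * f (s y)
    rw [h1]
    by_cases hyb : s y ∈ Metric.closedBall (p : EuclideanSpace ℂ (Fin n)) (min (r₁ / 2) r₂)
    · have hmem : s y ∈ W ∩ π ⁻¹' O :=
        ⟨(hOW y hy).1, by rw [Set.mem_preimage, (hOW y hy).2]; exact hy⟩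
      have hχ : χ (s y) = 1 := χ.one_of_mem_closedBall hyb
      have hwy : (w y : ℂ) ≠ 0 := by exact_mod_cast (hw0 y (hOe hy)).ne'
      have hmy : m (s y) = -(euclideanDiv v y / w y) := by
        simp [m, Set.indicator_of_mem hmem, hχ, m₀, (hOW y hy).2]
      rw [hmy, Complex.real_smul]
      field_simp
      ring
    · simp [hf0 _ hyb]
  · rintro _ ⟨x, hx, rfl⟩
    exact (hr₂W (Metric.closedBall_subset_closedBall (min_le_right _ _) hx)).2
  · intro y hy hyK
    refine (hf0 _ fun h => hyK ⟨e.symm y, h, e.right_inv (hOe hy)⟩).1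

end Chart

/-! ### Tangent vectors and sections of `T_{0,1}X` -/

section Geometry

variable {n : ℕ}

lemma eq_zero_of_mem_frontier {E : Type*} [TopologicalSpace E] {D V : Set E} {ρ : E → ℝ}
    (hD : IsOpen D) (hV : IsOpen V) (hρ : ContinuousOn ρ V) (hDV : D ∩ V = {x ∈ V | ρ x < 0})
    (hsub : frontier D ⊆ V) {x : E} (hx : x ∈ frontier D) : ρ x = 0 := by
  have hxV := hsub hx
  refine le_antisymm ?_ ?_
  · by_contra! h
    have h1 : ∀ᶠ y in 𝓝 x, y ∈ V ∧ 0 < ρ y :=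
      (hV.eventually_mem hxV).and ((hρ.continuousAt (hV.mem_nhds hxV)).eventually_const_lt h)
    obtain ⟨y, ⟨hyV, hy⟩, hyD⟩ := mem_closure_iff_nhds.1 hx.1 _ h1
    have : y ∈ {x ∈ V | ρ x < 0} := hDV ▸ ⟨hyD, hyV⟩
    exact lt_asymm hy this.2
  · by_contra! h
    have : x ∈ D ∩ V := hDV ▸ ⟨hxV, h⟩
    rw [hD.frontier_eq] at hx
    exact hx.2 this.1

/-- A chart of a hypersurface parametrizes the kernel of the derivative of a defining function. -/
lemma exists_fderiv_chart_eq {X : Set (EuclideanSpace ℂ (Fin n))}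
    {e : OpenPartialHomeomorph X (EuclideanSpace ℝ (Fin (2 * n - 1)))} (he : IsSmoothChart X e)
    {ρ : EuclideanSpace ℂ (Fin n) → ℝ} (h0 : ∀ x ∈ X, ρ x = 0)
    {y : EuclideanSpace ℝ (Fin (2 * n - 1))} (hy : y ∈ e.target)
    (hd : DifferentiableAt ℝ ρ (e.symm y)) (hρ : fderiv ℝ ρ (e.symm y) ≠ 0)
    {v : EuclideanSpace ℂ (Fin n)} (hv : fderiv ℝ ρ (e.symm y) v = 0) :
    ∃ u, fderiv ℝ (fun y => (e.symm y : EuclideanSpace ℂ (Fin n))) y u = v := by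
  set s : EuclideanSpace ℝ (Fin (2 * n - 1)) → EuclideanSpace ℂ (Fin n) :=
    fun y => (e.symm y : EuclideanSpace ℂ (Fin n)) with hs_def
  have hsd : HasFDerivAt s (fderiv ℝ s y) y :=
    ((he.contDiffOn.contDiffAt (e.open_target.mem_nhds hy)).differentiableAt
      (by simp)).hasFDerivAt
  have hcomp : (fderiv ℝ ρ (s y)).comp (fderiv ℝ s y) = 0 := by
    refine (HasFDerivAt.comp y (g := ρ) hd.hasFDerivAt hsd).unique ?_
    have : ρ ∘ s = fun _ => 0 := funext fun z => h0 _ (e.symm z).2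
    rw [this]
    exact hasFDerivAt_const _ _
  let A : EuclideanSpace ℝ (Fin (2 * n - 1)) →ₗ[ℝ] EuclideanSpace ℂ (Fin n) := fderiv ℝ s y
  let B : EuclideanSpace ℂ (Fin n) →ₗ[ℝ] ℝ := fderiv ℝ ρ (s y)
  have hle : LinearMap.range A ≤ LinearMap.ker B := by
    rintro _ ⟨u, rfl⟩
    exact DFunLike.congr_fun hcomp u
  have hB : LinearMap.range B = ⊤ := by
    refine LinearMap.range_eq_top.2 (LinearMap.surjective ?_)
    intro h
    exact hρ (ContinuousLinearMap.coe_injective h)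
  have h1 := LinearMap.finrank_range_add_finrank_ker B
  have h2 := LinearMap.finrank_range_of_inj (f := A) (he.injective y hy)
  rw [hB, finrank_top, Module.finrank_self, finrank_real_of_complex] at h1
  simp only [finrank_euclideanSpace, Fintype.card_fin] at h1 h2
  -- Both spaces have real dimension `2n - 1`, so the inclusion is an equality.
  have h3 := Submodule.eq_of_le_of_finrank_eq hle (by omega)
  have : v ∈ LinearMap.range A := h3 ▸ hv
  exact this

lemma mem_tangentVectors {X : Set (EuclideanSpace ℂ (Fin n))}
    {e : OpenPartialHomeomorph X (EuclideanSpace ℝ (Fin (2 * n - 1)))} (he : IsSmoothChart X e)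
    {x : X} (hx : x ∈ e.source) (u : EuclideanSpace ℝ (Fin (2 * n - 1))) :
    fderiv ℝ (fun y => (e.symm y : EuclideanSpace ℂ (Fin n))) (e x) u ∈ tangentVectors X x := by
  have hs := he.contDiffOn.contDiffAt (e.open_target.mem_nhds (e.map_source hx))
  have hl : HasDerivAt (fun t : ℝ => e x + t • u) u 0 := by
    simpa using ((hasDerivAt_id (0 : ℝ)).smul_const u).const_add (e x)
  have h0 : e x + (0 : ℝ) • u = e x := by simp
  refine ⟨fun t => (e.symm (e x + t • u) : EuclideanSpace ℂ (Fin n)), ?_,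
    Filter.Eventually.of_forall fun t => Subtype.coe_prop _, ?_, ?_⟩
  · simp [e.left_inv hx]
  · refine ContDiffAt.comp (0 : ℝ) (g := fun y => (e.symm y : EuclideanSpace ℂ (Fin n)))
      (f := fun t : ℝ => e x + t • u) ?_ (by fun_prop)
    rwa [h0]
  · refine (HasFDerivAt.comp_hasDerivAt (0 : ℝ)
      (l := fun y => (e.symm y : EuclideanSpace ℂ (Fin n))) ?_ hl).deriv
    rw [h0]
    exact (hs.differentiableAt (by simp)).hasFDerivAt

/-- There is a section of `T_{0,1}X` that does not vanish at a given point of `X = bD`, and whose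
components are annihilated by the differential of a defining function. -/
lemma exists_section_ne_zero (hn : 2 ≤ n) {V : Set (EuclideanSpace ℂ (Fin n))}
    {ρ : EuclideanSpace ℂ (Fin n) → ℝ} (hV : IsOpen V) (hρ : ContDiffOn ℝ ∞ ρ V)
    {p : EuclideanSpace ℂ (Fin n)} (hp : p ∈ V) (hdp : fderiv ℝ ρ p ≠ 0) :
    ∃ Z : ComplexVectorField n, Z.re p ≠ 0 ∧ ∀ x, Z.im x = Complex.I • Z.re x ∧
      fderiv ℝ ρ x (Z.re x) = 0 ∧ fderiv ℝ ρ x (Z.im x) = 0 := by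
  -- This is `2∂ρ`: complex linear with real part `dρ`, so its kernel is a `J`-invariant subspace of
  -- the kernel of `dρ`.
  let d : EuclideanSpace ℂ (Fin n) → EuclideanSpace ℂ (Fin n) → ℂ := fun x v =>
    Complex.ofRealCLM (fderiv ℝ ρ x v) - Complex.I * Complex.ofRealCLM (fderiv ℝ ρ x (Complex.I • v))
  have hd (v : EuclideanSpace ℂ (Fin n)) : ContDiffOn ℝ ∞ (fun x => d x v) V := by
    have h (v : EuclideanSpace ℂ (Fin n)) :
        ContDiffOn ℝ ∞ (fun x => Complex.ofRealCLM (fderiv ℝ ρ x v)) V :=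
      Complex.ofRealCLM.contDiff.comp_contDiffOn
        ((hρ.fderiv_of_isOpen hV (m := ∞) (by simp)).clm_apply contDiffOn_const)
    exact (h v).sub (contDiffOn_const.mul (h _))
  have hre (x v : EuclideanSpace ℂ (Fin n)) : (d x v).re = fderiv ℝ ρ x v := by simp [d]
  have hadd (x v v' : EuclideanSpace ℂ (Fin n)) : d x (v - v') = d x v - d x v' := by
    simp only [d, smul_sub, map_sub]
    ring
  have hI (x v : EuclideanSpace ℂ (Fin n)) : d x (Complex.I • v) = Complex.I * d x v := by
    simp only [d, smul_smul, Complex.I_mul_I, neg_smul, one_smul, map_neg]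
    linear_combination (Complex.ofRealCLM (fderiv ℝ ρ x (Complex.I • v))) * Complex.I_mul_I
  have hsmul (x v : EuclideanSpace ℂ (Fin n)) (c : ℂ) : d x (c • v) = c * d x v := by
    have hr (t : ℝ) (v : EuclideanSpace ℂ (Fin n)) : d x ((t : ℂ) • v) = t * d x v := by
      simp only [d, smul_comm Complex.I, Complex.coe_smul, map_smul, Complex.ofRealCLM_apply,
        smul_eq_mul, Complex.ofReal_mul]
      ring
    have hc : c • v = (c.re : ℂ) • v - (-(c.im) : ℝ) • (Complex.I • v) := by
      conv_lhs => rw [← Complex.re_add_im c]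
      rw [add_smul, mul_smul, neg_smul, sub_neg_eq_add, Complex.coe_smul c.im]
    rw [hc, hadd, hr, ← Complex.coe_smul (-c.im), hr, hI]
    conv_rhs => rw [← Complex.re_add_im c]
    push_cast
    ring
  obtain ⟨j, hj⟩ : ∃ j, d p (EuclideanSpace.single j 1) ≠ 0 := by
    by_contra! h
    refine hdp (ContinuousLinearMap.ext fun v => ?_)
    let dL : EuclideanSpace ℂ (Fin n) →ₗ[ℂ] ℂ :=
      { toFun := d p
        map_add' := fun v v' => by
          rw [← sub_neg_eq_add v v', hadd, show -v' = (-1 : ℂ) • v' by simp, hsmul]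
          ring
        map_smul' := fun c v => hsmul p v c }
    have h1 : dL = 0 := by
      refine (EuclideanSpace.basisFun (Fin n) ℂ).toBasis.ext fun i => ?_
      simpa [dL] using h i
    rw [← hre, show d p v = dL v from rfl, h1]
    simp
  have : Nontrivial (Fin n) := Fin.nontrivial_iff_two_le.2 hn
  -- The second index exists because `n ≥ 2`; `a₀` below lies in the kernel of `d` and has `k`-th
  -- coordinate `d(e_j)`, nonzero at `p`.
  obtain ⟨k, hkj⟩ := exists_ne j
  obtain ⟨r, hr, hrV⟩ := Metric.nhds_basis_closedBall.mem_iff.1 (hV.mem_nhds hp)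
  let χ : ContDiffBump p := ⟨r / 2, r, by positivity, by linarith⟩
  let a₀ : EuclideanSpace ℂ (Fin n) → EuclideanSpace ℂ (Fin n) := fun x =>
    d x (EuclideanSpace.single j 1) • EuclideanSpace.single k 1 -
      d x (EuclideanSpace.single k 1) • EuclideanSpace.single j 1
  have ha₀ (x : EuclideanSpace ℂ (Fin n)) : d x (a₀ x) = 0 := by
    simp only [a₀, hadd, hsmul]
    ring
  let a : EuclideanSpace ℂ (Fin n) → EuclideanSpace ℂ (Fin n) := V.indicator fun x => χ x • a₀ x
  have ha : ContDiff ℝ ∞ a := by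
    refine contDiff_indicator hV (isClosed_tsupport χ) ?_ ?_ ?_
    · rw [χ.tsupport_eq]
      exact hrV
    · exact χ.contDiff.contDiffOn.smul
        (((hd _).smul contDiffOn_const).sub ((hd _).smul contDiffOn_const))
    · intro x _ hx
      simp [image_eq_zero_of_notMem_tsupport hx]
  have hda (x : EuclideanSpace ℂ (Fin n)) : d x (a x) = 0 := by
    by_cases hx : x ∈ V
    · simp only [a, Set.indicator_of_mem hx]
      rw [← Complex.coe_smul, hsmul, ha₀, mul_zero]
    · simp [a, hx, d]
  refine ⟨⟨a, fun x => Complex.I • a x, ha, ha.const_smul Complex.I⟩, ?_, fun x => ⟨rfl, ?_, ?_⟩⟩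
  · intro h
    have hχ : χ p = 1 := χ.one_of_mem_closedBall (Metric.mem_closedBall_self χ.rIn_pos.le)
    have h1 : a₀ p = 0 := by simpa [a, hp, hχ] using h
    have h2 := congrArg (fun z : EuclideanSpace ℂ (Fin n) => z k) h1
    simp [a₀, hkj] at h2
    exact hj h2
  · rw [← hre, hda, Complex.zero_re]
  · rw [← hre, hI, hda, mul_zero, Complex.zero_re]

end Geometry

/-! ### Test functions, CR functions and formal adjoints -/

section Adjoint

variable {n : ℕ}

/-- Smooth functions with prescribed linear part at `p`, supported in small balls, and with
uniformly bounded derivatives. -/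
lemma exists_scaled_linear {E : Type*} [NormedAddCommGroup E] [NormedSpace ℝ E]
    [FiniteDimensional ℝ E] (p : E) (ℓ : E →L[ℝ] ℂ) :
    ∃ M : ℝ, 0 ≤ M ∧ ∀ δ : ℝ, 0 < δ → ∃ φ : E → ℂ, ContDiff ℝ ∞ φ ∧
      tsupport φ ⊆ Metric.closedBall p δ ∧ φ p = 0 ∧ fderiv ℝ φ p = ℓ ∧
      ∀ x, ‖φ x‖ ≤ δ * M ∧ ‖fderiv ℝ φ x‖ ≤ M := by
  let η : ContDiffBump (0 : E) := ⟨1 / 2, 1, by norm_num, by norm_num⟩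
  let θ : E → ℂ := fun x => η x • ℓ x
  have hθ : ContDiff ℝ ∞ θ := η.contDiff.smul ℓ.contDiff
  have hθc : HasCompactSupport θ := η.hasCompactSupport.smul_right
  have hθ0 : fderiv ℝ θ 0 = ℓ := by
    have : θ =ᶠ[𝓝 0] ℓ := by
      filter_upwards [η.eventuallyEq_one] with x hx
      simp [θ, hx]
    rw [this.fderiv_eq, ℓ.fderiv]
  obtain ⟨M₁, hM₁⟩ := hθc.exists_bound_of_continuous hθ.continuous
  obtain ⟨M₂, hM₂⟩ := (hθc.fderiv ℝ).exists_bound_of_continuous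
    (hθ.continuous_fderiv (by simp))
  refine ⟨max M₁ M₂, ((norm_nonneg _).trans (hM₁ 0)).trans (le_max_left _ _), fun δ hδ => ?_⟩
  -- This scaling shrinks the support and the size of `θ` but leaves the bound on its derivative
  -- unchanged.
  let φ : E → ℂ := fun x => δ • θ (δ⁻¹ • (x - p))
  have hd (x : E) : fderiv ℝ φ x = fderiv ℝ θ (δ⁻¹ • (x - p)) := by
    have h1 : HasFDerivAt (fun x : E => δ⁻¹ • (x - p)) (δ⁻¹ • ContinuousLinearMap.id ℝ E) x :=
      ((hasFDerivAt_id x).sub_const p).const_smul δ⁻¹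
    have h2 := ((hθ.differentiable (by simp) (δ⁻¹ • (x - p))).hasFDerivAt.comp x h1).const_smul δ
    refine (show HasFDerivAt φ _ x from h2).fderiv.trans ?_
    ext v
    simp [hδ.ne']
  refine ⟨φ, ?_, ?_, ?_, ?_, fun x => ⟨?_, ?_⟩⟩
  · exact (hθ.comp ((contDiff_id.sub contDiff_const).const_smul δ⁻¹)).const_smul δ
  · refine closure_minimal (fun x hx => ?_) Metric.isClosed_closedBall
    by_contra h
    rw [Metric.mem_closedBall, not_le, dist_eq_norm] at h
    refine hx ?_
    have : η (δ⁻¹ • (x - p)) = 0 := by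
      refine η.zero_of_le_dist ?_
      rw [dist_zero_right, norm_smul, norm_inv, Real.norm_of_nonneg hδ.le]
      rw [← div_eq_inv_mul, le_div_iff₀ hδ]
      change 1 * δ ≤ _
      linarith
    simp [φ, θ, this]
  · simp [φ, θ]
  · rw [hd, sub_self, smul_zero, hθ0]
  · rw [norm_smul, Real.norm_of_nonneg hδ.le]
    exact mul_le_mul_of_nonneg_left ((hM₁ _).trans (le_max_left _ _)) hδ.le
  · rw [hd]
    exact (hM₂ _).trans (le_max_right _ _)

section measure

variable {X : Set (EuclideanSpace ℂ (Fin n))} {μ : Measure X}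

/-- The final test function is the indicator of a neighbourhood of the peak point, which must not be
null. -/
lemma measure_pos_of_isOpen [h : IsSmoothPositiveMeasure X μ] {U : Set X} (hU : IsOpen U) {p : X}
    (hp : p ∈ U) : 0 < μ U := by
  obtain ⟨e, w, -, hx, hw, hw0, hμ⟩ := h.exists_density p
  have hyt := e.map_source hx
  let T : Set (EuclideanSpace ℝ (Fin (2 * n - 1))) :=
    (e.target ∩ e.symm ⁻¹' U) ∩ (e.target ∩ w ⁻¹' Set.Ioi (w (e p) / 2))
  have hT : IsOpen T := (e.symm.isOpen_inter_preimage hU).inter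
    (hw.continuousOn.isOpen_inter_preimage e.open_target isOpen_Ioi)
  have hpT : e p ∈ T := by
    refine ⟨⟨hyt, ?_⟩, hyt, ?_⟩
    · simpa [e.left_inv hx] using hp
    · have := hw0 _ hyt
      simp only [Set.mem_preimage, Set.mem_Ioi]
      linarith
  have he : AEMeasurable e (μ.restrict e.source) :=
    e.continuousOn.aemeasurable e.open_source.measurableSet
  have h1 : (μ.restrict e.source).map e T ≤ μ U := by
    rw [Measure.map_apply_of_aemeasurable he hT.measurableSet,
      Measure.restrict_apply' e.open_source.measurableSet]
    refine measure_mono fun x hx => ?_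
    simpa [e.left_inv hx.2] using hx.1.1.2
  refine lt_of_lt_of_le ?_ h1
  rw [hμ, withDensity_apply _ hT.measurableSet, Measure.restrict_restrict hT.measurableSet,
    Set.inter_eq_self_of_subset_left fun y hy => hy.1.1]
  calc 0 < ENNReal.ofReal (w (e p) / 2) * volume T :=
        ENNReal.mul_pos (by simpa using hw0 _ hyt) (hT.measure_pos volume ⟨_, hpT⟩).ne'
    _ = ∫⁻ _ in T, ENNReal.ofReal (w (e p) / 2) := by rw [setLIntegral_const]
    _ ≤ ∫⁻ y in T, ENNReal.ofReal (w y) := setLIntegral_mono' hT.measurableSet fun y hy =>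
        ENNReal.ofReal_le_ofReal (le_of_lt hy.2.2)

/-- Cauchy–Riemann: with `Z = a + i(Ja)`, complex linearity of `dH` gives `ZH = dH(a) + i² dH(a) =
0`. -/
lemma isCR_of_holomorphic {H : EuclideanSpace ℂ (Fin n) → ℂ} (hH : ContDiff ℂ ∞ H) :
    IsCR μ fun x : X => H x := by
  intro Z hZ φ ψ _ _ h
  rw [h H (hH.restrict_scalars ℝ)]
  refine integral_eq_zero_of_ae (Filter.Eventually.of_forall fun x => ?_)
  have h1 := (hH.differentiable (by simp) (x : EuclideanSpace ℂ (Fin n))).fderiv_restrictScalars ℝ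
  simp only [ComplexVectorField.apply, (hZ x x.2).2.2, h1, ContinuousLinearMap.coe_restrictScalars',
    map_smul, smul_eq_mul, Pi.zero_apply]
  linear_combination (φ x * fderiv ℂ H x (Z.re x)) * Complex.I_mul_I

/-- The projection is self-adjoint and fixes the CR function `H`; the integrals are inner products
against `H`. -/
lemma integral_szegoProjection_mul_conj [IsFiniteMeasure μ] [CompactSpace X] (f : Lp ℂ 2 μ)
    {H : EuclideanSpace ℂ (Fin n) → ℂ} (hH : ContDiff ℂ ∞ H) :
    ∫ x : X, szegoProjection μ f x * star (H x) ∂μ = ∫ x : X, f x * star (H x) ∂μ := by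
  have hm : MemLp (fun x : X => H x) 2 μ :=
    (hH.continuous.comp continuous_subtype_val).memLp_of_hasCompactSupport
      (HasCompactSupport.of_compactSpace _)
  have hinner (g : Lp ℂ 2 μ) : inner ℂ hm.toLp g = ∫ x : X, g x * star (H x) ∂μ := by
    rw [L2.inner_def]
    refine integral_congr_ae ?_
    filter_upwards [hm.coeFn_toLp] with x hx
    simp [hx]
  have hmem : hm.toLp ∈ CR2 μ := by
    intro Z hZ φ ψ hφ hψ h
    rw [← isCR_of_holomorphic hH Z hZ φ ψ hφ hψ h]
    refine integral_congr_ae ?_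
    filter_upwards [hm.coeFn_toLp] with x hx
    rw [hx]
  rw [← hinner, ← hinner, szegoProjection, ← Submodule.inner_starProjection_left_eq_right,
    Submodule.starProjection_eq_self_iff.2 hmem]

lemma integral_szegoProjection_mul_adjoint [IsLocallyFiniteMeasure μ] (f : Lp ℂ 2 μ)
    {Z : ComplexVectorField n} (hZ : Z.IsSectionT01 X) {φ ψ : EuclideanSpace ℂ (Fin n) → ℂ}
    (hφ : IsTestFunction X φ) (hψ : IsTestFunction X ψ) (h : IsFormalAdjoint μ Z φ ψ) :
    ∫ x : X, szegoProjection μ f x * ψ x ∂μ = 0 :=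
  (Submodule.starProjection_apply_mem (CR2 μ) f : IsCR μ _) Z hZ φ ψ hφ hψ h

end measure

lemma contDiff_apply (Z : ComplexVectorField n) {φ : EuclideanSpace ℂ (Fin n) → ℂ}
    (hφ : ContDiff ℝ ∞ φ) : ContDiff ℝ ∞ (Z.apply φ) :=
  ((hφ.fderiv_right (m := ∞) (by simp)).clm_apply Z.contDiff_re).add
    (contDiff_const.mul ((hφ.fderiv_right (m := ∞) (by simp)).clm_apply Z.contDiff_im))

/-- Near a point of the boundary, the formal adjoint of a suitable section `Z` of `T_{0,1}X` that
does not vanish at that point is `-Z` plus multiplication by a smooth function. -/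
lemma exists_section_formalAdjoint (hn : 2 ≤ n) {D : Set (EuclideanSpace ℂ (Fin n))}
    (hD : IsSmoothlyBoundedDomain D) (hb : Bornology.IsBounded D) (μ : Measure (frontier D))
    [IsFiniteMeasure μ] [h : IsSmoothPositiveMeasure (frontier D) μ] (p : frontier D) :
    ∃ (Z : ComplexVectorField n) (m : EuclideanSpace ℂ (Fin n) → ℂ) (r : ℝ),
      Z.IsSectionT01 (frontier D) ∧ Z.re p ≠ 0 ∧ ContDiff ℝ ∞ m ∧ 0 < r ∧
      ∀ φ, ContDiff ℝ ∞ φ → tsupport φ ⊆ Metric.closedBall (p : EuclideanSpace ℂ (Fin n)) r →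
        IsFormalAdjoint μ Z φ fun x => m x * φ x - Z.apply φ x := by
  obtain ⟨V, ρ, hV, hsub, hρ, hdρ, hDV⟩ := hD.exists_defining
  have h0 : ∀ x ∈ frontier D, ρ x = 0 := fun x hx =>
    eq_zero_of_mem_frontier hD.isOpen hV hρ.continuousOn hDV hsub hx
  have hd : ∀ x ∈ frontier D, DifferentiableAt ℝ ρ x := fun x hx =>
    (hρ.contDiffAt (hV.mem_nhds (hsub hx))).differentiableAt (by simp)
  obtain ⟨Z, hZp, hZ⟩ := exists_section_ne_zero hn hV hρ (hsub p.2) (hdρ p p.2)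
  have hX : IsCompact (frontier D) :=
    Metric.isCompact_of_isClosed_isBounded isClosed_frontier (hb.closure.subset
      frontier_subset_closure)
  have hcs : CompactSpace (frontier D) := isCompact_iff_compactSpace.1 hX
  have hsec : Z.IsSectionT01 (frontier D) := by
    intro x hx
    obtain ⟨e, w, he, hxe, -⟩ := h.exists_density ⟨x, hx⟩
    have key {v : EuclideanSpace ℂ (Fin n)} (hv : fderiv ℝ ρ x v = 0) :
        v ∈ tangentVectors (frontier D) x := by
      have hxx : (e.symm (e ⟨x, hx⟩) : EuclideanSpace ℂ (Fin n)) = x := by rw [e.left_inv hxe]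
      obtain ⟨u, rfl⟩ := exists_fderiv_chart_eq he h0 (e.map_source hxe)
        (hxx.symm ▸ hd x hx) (hxx.symm ▸ hdρ x hx) (hxx.symm ▸ hv)
      exact mem_tangentVectors he hxe u
    exact ⟨key (hZ x).2.1, key (hZ x).2.2, (hZ x).1⟩
  obtain ⟨e, w, he, hpe, hw, hw0, hμ⟩ := h.exists_density p
  obtain ⟨m₁, r₁, hm₁, hr₁, H₁⟩ := exists_integral_fderiv_eq hX he hw hw0 hμ hpe Z.contDiff_re
    fun y hy => exists_fderiv_chart_eq he h0 hy (hd _ (e.symm y).2) (hdρ _ (e.symm y).2) (hZ _).2.1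
  obtain ⟨m₂, r₂, hm₂, hr₂, H₂⟩ := exists_integral_fderiv_eq hX he hw hw0 hμ hpe Z.contDiff_im
    fun y hy => exists_fderiv_chart_eq he h0 hy (hd _ (e.symm y).2) (hdρ _ (e.symm y).2) (hZ _).2.2
  refine ⟨Z, fun x => m₁ x + Complex.I * m₂ x, min r₁ r₂, hsec, hZp,
    hm₁.add (contDiff_const.mul hm₂), lt_min hr₁ hr₂, fun φ hφ hφs g hg => ?_⟩
  have hint {f : EuclideanSpace ℂ (Fin n) → ℂ} (hf : Continuous f) :
      Integrable (fun x : frontier D => f x) μ :=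
    (hf.comp continuous_subtype_val).integrable_of_hasCompactSupport
      (HasCompactSupport.of_compactSpace _)
  -- Integration by parts is applied to `φ g`; the Leibniz rule then moves `Z` from `g` to `φ`.
  have hf : ContDiff ℝ ∞ (fun x => φ x * g x) := hφ.mul hg
  have hfs : tsupport (fun x => φ x * g x) ⊆ tsupport φ := tsupport_mul_subset_left
  have h1 := H₁ _ hf (hfs.trans (hφs.trans (Metric.closedBall_subset_closedBall (min_le_left _ _))))
  have h2 := H₂ _ hf
    (hfs.trans (hφs.trans (Metric.closedBall_subset_closedBall (min_le_right _ _))))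
  have hfd {b : EuclideanSpace ℂ (Fin n) → EuclideanSpace ℂ (Fin n)} (hb : ContDiff ℝ ∞ b) :
      Continuous fun x => fderiv ℝ (fun x => φ x * g x) x (b x) :=
    (hf.continuous_fderiv (by simp)).clm_apply hb.continuous
  have hZf (x : EuclideanSpace ℂ (Fin n)) :
      Z.apply (fun x => φ x * g x) x = φ x * Z.apply g x + g x * Z.apply φ x := by
    have : fderiv ℝ (fun x => φ x * g x) x = φ x • fderiv ℝ g x + g x • fderiv ℝ φ x :=
      fderiv_fun_mul (hφ.differentiable (by simp) x) (hg.differentiable (by simp) x)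
    simp only [ComplexVectorField.apply, this, _root_.add_apply,
      _root_.smul_apply, smul_eq_mul]
    ring
  have h3 : ∫ x : frontier D, Z.apply (fun x => φ x * g x) x ∂μ =
      ∫ x : frontier D, (m₁ x + Complex.I * m₂ x) * (φ x * g x) ∂μ := by
    simp only [ComplexVectorField.apply, add_mul, mul_assoc]
    rw [integral_add (hint (hfd Z.contDiff_re))
      (hint (continuous_const.fun_mul (hfd Z.contDiff_im))),
      integral_add (hint (hm₁.continuous.fun_mul hf.continuous))
      (hint (continuous_const.fun_mul (hm₂.continuous.fun_mul hf.continuous))),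
      integral_const_mul, integral_const_mul, h1, h2]
  have hcm : Continuous fun x => m₁ x + Complex.I * m₂ x :=
    hm₁.continuous.add (continuous_const.mul hm₂.continuous)
  have hZφ := (contDiff_apply Z hφ).continuous
  have hZg := (contDiff_apply Z hg).continuous
  have i1 := hint (hφ.continuous.fun_mul hZg)
  have i2 := hint (hg.continuous.fun_mul hZφ)
  simp only [hZf] at h3
  rw [integral_add i1 i2] at h3
  rw [eq_comm, ← add_right_cancel_iff, h3, eq_comm]
  refine (integral_add (hint (hg.continuous.fun_mul ((hcm.fun_mul hφ.continuous).fun_sub hZφ))) i2).symm.trans ?_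
  refine integral_congr_ae (Filter.Eventually.of_forall fun x => ?_)
  ring

end Adjoint

/-! ### Peak functions -/

section Main

variable {n : ℕ}

/-- A farthest point of a compact set from a point off the set is a peak point of a holomorphic
polynomial. -/
lemma exists_peak_function {X : Set (EuclideanSpace ℂ (Fin n))} (hX : IsCompact X)
    (hne : X.Nonempty) {c : EuclideanSpace ℂ (Fin n)} (hc : c ∉ X) :
    ∃ p ∈ X, ∃ h : EuclideanSpace ℂ (Fin n) → ℂ, ContDiff ℂ ∞ h ∧ h p = 1 ∧
      ∀ x ∈ X, x ≠ p → ‖h x‖ < 1 := by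
  obtain ⟨p, hp, hmax⟩ := hX.exists_isMaxOn hne
    (continuous_norm.comp (continuous_id.sub (continuous_const (y := c)))).continuousOn
  let q := p - c
  have hq : q ≠ 0 := fun h => hc (sub_eq_zero.1 h ▸ hp)
  have hq0 : 0 < ‖q‖ ^ 2 := by positivity
  -- On `X` the normalized inner product lies in the closed unit disc, which `z ↦ (1 + z)/2` maps
  -- into itself, reaching the circle only at 1.
  refine ⟨p, hp, fun x => (1 + inner ℂ q (x - c) / (‖q‖ ^ 2 : ℝ)) / 2, ?_, ?_, fun x hx hxp => ?_⟩
  · have : ContDiff ℂ ∞ fun x => inner ℂ q (x - c) :=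
      (innerSL ℂ q).contDiff.comp (contDiff_id.sub contDiff_const)
    exact (contDiff_const.add (this.div_const _)).div_const _
  · have : inner ℂ q (p - c) = ((‖q‖ ^ 2 : ℝ) : ℂ) := by
      rw [show p - c = q from rfl, inner_self_eq_norm_sq_to_K]
      simp
    simp only [this, div_self (Complex.ofReal_ne_zero.2 hq0.ne')]
    norm_num
  · have hle : ‖x - c‖ ≤ ‖q‖ := hmax hx
    set ζ := inner ℂ q (x - c) with hζ
    have h1 : ‖ζ‖ ≤ ‖q‖ ^ 2 := (norm_inner_le_norm _ _).trans (by nlinarith [norm_nonneg q])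
    -- Expand `0 < ‖q - (x - c)‖²` and use `‖x - c‖ ≤ ‖q‖`: the value 1 is taken only at `p`.
    have h2 : ζ.re < ‖q‖ ^ 2 := by
      have h3 := norm_sub_sq (𝕜 := ℂ) q (x - c)
      have h4 : 0 < ‖q - (x - c)‖ := norm_pos_iff.2 fun h => hxp <| by
        rw [show q - (x - c) = p - x by simp [q], sub_eq_zero] at h
        exact h.symm
      rw [← hζ] at h3
      simp only [RCLike.re_to_complex] at h3
      have h5 : 0 < ‖q - (x - c)‖ ^ 2 := by positivity
      have h6 : ‖x - c‖ ^ 2 ≤ ‖q‖ ^ 2 := by gcongr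
      linarith
    have h7 : ‖((‖q‖ ^ 2 : ℝ) : ℂ) + ζ‖ ^ 2 < (2 * ‖q‖ ^ 2) ^ 2 := by
      have h8 : ‖ζ‖ ^ 2 ≤ (‖q‖ ^ 2) ^ 2 := by gcongr
      rw [Complex.sq_norm, Complex.normSq_apply] at h8 ⊢
      simp only [Complex.add_re, Complex.add_im, Complex.ofReal_re, Complex.ofReal_im, zero_add]
      nlinarith
    have h9 : ‖((‖q‖ ^ 2 : ℝ) : ℂ) + ζ‖ < 2 * ‖q‖ ^ 2 :=
      lt_of_pow_lt_pow_left₀ 2 (by positivity) h7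
    have h10 : (1 + ζ / ((‖q‖ ^ 2 : ℝ) : ℂ)) / 2 =
        (((‖q‖ ^ 2 : ℝ) : ℂ) + ζ) / ((2 * ‖q‖ ^ 2 : ℝ) : ℂ) := by
      have : ((‖q‖ ^ 2 : ℝ) : ℂ) ≠ 0 := Complex.ofReal_ne_zero.2 hq0.ne'
      rw [Complex.ofReal_mul]
      rw [Complex.ofReal_ofNat]
      field_simp
    change ‖(1 + ζ / ((‖q‖ ^ 2 : ℝ) : ℂ)) / 2‖ < 1
    rw [h10, norm_div, Complex.norm_real, Real.norm_of_nonneg (by positivity), div_lt_one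
      (by positivity)]
    exact h9

/-- The powers of a peak function are uniformly small off a neighbourhood of the peak point. -/
lemma exists_pow_le_of_peak {Y : Type*} [TopologicalSpace Y] [CompactSpace Y] {h : Y → ℂ}
    (hh : Continuous h) {p : Y} (hlt : ∀ x ≠ p, ‖h x‖ < 1) {U : Set Y} (hU : IsOpen U)
    (hp : p ∈ U) {ε : ℝ} (hε : 0 < ε) : ∃ N : ℕ, ∀ x ∉ U, ‖h x‖ ^ N ≤ ε := by
  rcases (Uᶜ).eq_empty_or_nonempty with he | hne
  · exact ⟨0, fun x hx => absurd hx (by simpa using Set.eq_empty_iff_forall_notMem.1 he x)⟩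
  obtain ⟨x₀, hx₀, hmax⟩ := hU.isClosed_compl.isCompact.exists_isMaxOn hne hh.norm.continuousOn
  obtain ⟨N, hN⟩ := exists_pow_lt_of_lt_one hε (hlt x₀ fun h => hx₀ (h ▸ hp))
  exact ⟨N, fun x hx => (pow_le_pow_left₀ (norm_nonneg _) (hmax hx) N).trans hN.le⟩

/-- `g` and `A` are continuous, `g` vanishes at `p`, and pairing `T f` with `g` amounts to pairing
`f` with `A`. -/
structure IsTransposePair {Y : Type*} [TopologicalSpace Y] [MeasurableSpace Y] {μ : Measure Y}
    (T : Lp ℂ 2 μ →L[ℂ] Lp ℂ 2 μ) (p : Y) (g A : Y → ℂ) : Prop where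
  continuous_left : Continuous g
  continuous_right : Continuous A
  left_eq_zero : g p = 0
  integral_eq : ∀ f : Lp ℂ 2 μ, ∫ x, T f x * g x ∂μ = ∫ x, f x * A x ∂μ

/-! ### The gliding hump and unboundedness on `L¹` -/

section GlidingHump

variable {Y : Type*} [TopologicalSpace Y] [CompactSpace Y] [MeasurableSpace Y] [BorelSpace Y]
  {μ : Measure Y} [IsFiniteMeasure μ] {T : Lp ℂ 2 μ →L[ℂ] Lp ℂ 2 μ}
  {p : Y}

lemma integrable_Lp_mul_continuous (f : Lp ℂ 2 μ) {g : Y → ℂ} (hg : Continuous g) :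
    Integrable (fun x => f x * g x) μ :=
  (Lp.memLp f).integrable_mul (q := 2) (hg.memLp_of_hasCompactSupport (HasCompactSupport.of_compactSpace g))

lemma IsTransposePair.add {g g' A A' : Y → ℂ} (h : IsTransposePair T p g A)
    (h' : IsTransposePair T p g' A') :
    IsTransposePair T p (fun x => g x + g' x) (fun x => A x + A' x) where
  continuous_left := h.continuous_left.add h'.continuous_left
  continuous_right := h.continuous_right.add h'.continuous_right
  left_eq_zero := by rw [h.left_eq_zero, h'.left_eq_zero, add_zero]
  integral_eq f := by
    simp only [mul_add]
    rw [integral_add (integrable_Lp_mul_continuous _ h.continuous_left)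
      (integrable_Lp_mul_continuous _ h'.continuous_left),
      integral_add (integrable_Lp_mul_continuous _ h.continuous_right)
      (integrable_Lp_mul_continuous _ h'.continuous_right), h.integral_eq, h'.integral_eq]

/-- A gliding hump argument: sums of transposed pairs that concentrate at `p`. -/
lemma exists_isTransposePair_nat {M : ℝ} (hM : 0 ≤ M)
    (H : ∀ U : Set Y, IsOpen U → p ∈ U → ∀ ε : ℝ, 0 < ε → ∃ g A : Y → ℂ,
      IsTransposePair T p g A ∧ A p = 1 ∧ (∀ x, ‖g x‖ ≤ M) ∧ ∀ x ∉ U, ‖g x‖ ≤ ε)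
    {ε : ℝ} (hε : 0 < ε) (J : ℕ) :
    ∃ g A : Y → ℂ, IsTransposePair T p g A ∧ A p = J ∧ ∀ x, ‖g x‖ ≤ M + J * ε := by
  induction J with
  | zero => exact ⟨0, 0, ⟨continuous_zero, continuous_zero, rfl, by simp⟩, by simp, by simp [hM]⟩
  | succ J ih =>
    obtain ⟨g, A, hgA, hA, hg⟩ := ih
    -- The new hump is at most `ε` wherever the old sum is at least `ε`; elsewhere the old sum costs
    -- less than `ε` on top of `M`.
    obtain ⟨g', A', hgA', hA', hg', hg'U⟩ := H {x | ‖g x‖ < ε}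
      (isOpen_lt hgA.continuous_left.norm continuous_const) (by simpa [hgA.left_eq_zero]) ε hε
    refine ⟨_, _, hgA.add hgA', by simp [hA, hA'], fun x => (norm_add_le _ _).trans ?_⟩
    push_cast
    by_cases hx : ‖g x‖ < ε
    · have := hg' x
      have : 0 ≤ J * ε := by positivity
      linarith
    · have := hg'U x hx
      have := hg x
      linarith

/-- If transposed pairs concentrate at a point of the support of `μ`, then `T` is unbounded on
`L¹`. -/
lemma not_isBoundedOnL1 (hμ : ∀ U : Set Y, IsOpen U → p ∈ U → 0 < μ U) {M : ℝ} (hM : 0 ≤ M)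
    (H : ∀ U : Set Y, IsOpen U → p ∈ U → ∀ ε : ℝ, 0 < ε → ∃ g A : Y → ℂ,
      IsTransposePair T p g A ∧ A p = 1 ∧ (∀ x, ‖g x‖ ≤ M) ∧ ∀ x ∉ U, ‖g x‖ ≤ ε) :
    ¬ IsBoundedOnL1 T := by
  rintro ⟨C, hC⟩
  -- With `ε = 1/J` the sum is bounded by `M + 1`. Testing on `U` gives `(J - 1) μ(U) ≤ C (M + 1)
  -- μ(U)`, which this `J` violates.
  obtain ⟨J, hJ⟩ := exists_nat_gt (1 + C * (M + 1))
  have hJ0 : (0 : ℝ) < J := lt_of_le_of_lt (by positivity) hJ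
  obtain ⟨g, A, hgA, hA, hg⟩ := exists_isTransposePair_nat hM H (inv_pos.2 hJ0) J
  rw [mul_inv_cancel₀ hJ0.ne'] at hg
  let U : Set Y := {x | ‖A x - J‖ < 1}
  have hU : IsOpen U := isOpen_lt (hgA.continuous_right.sub continuous_const).norm continuous_const
  have hpU : p ∈ U := by simp [U, hA]
  have hpos : 0 < μ.real U := ENNReal.toReal_pos (hμ U hU hpU).ne' (measure_ne_top μ U)
  let f : Lp ℂ 2 μ := indicatorConstLp 2 hU.measurableSet (measure_ne_top μ U) (1 : ℂ)
  have hf : f =ᵐ[μ] U.indicator fun _ => (1 : ℂ) := indicatorConstLp_coeFn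
  have hf1 : eLpNorm f 1 μ = μ U := by
    rw [eLpNorm_congr_ae hf, eLpNorm_indicator_const hU.measurableSet one_ne_zero ENNReal.one_ne_top]
    simp
  have hTf : Integrable (T f) μ := (Lp.memLp (T f)).integrable (by norm_num)
  have hTf1 : ∫ x, ‖T f x‖ ∂μ ≤ C * μ.real U := by
    have h1 := hC f ((Lp.memLp f).mono_exponent (by norm_num))
    rw [hf1] at h1
    rw [integral_norm_eq_lintegral_enorm hTf.1, ← eLpNorm_one_eq_lintegral_enorm]
    refine (ENNReal.toReal_mono (ENNReal.mul_ne_top ENNReal.coe_ne_top (measure_ne_top μ U))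
      h1).trans_eq ?_
    rw [ENNReal.toReal_mul]
    rfl
  have hup : ‖∫ x, T f x * g x ∂μ‖ ≤ C * μ.real U * (M + 1) := by
    calc ‖∫ x, T f x * g x ∂μ‖ ≤ ∫ x, ‖T f x‖ * (M + 1) ∂μ := by
          refine norm_integral_le_of_norm_le (hTf.norm.mul_const _)
            (Filter.Eventually.of_forall fun x => ?_)
          rw [norm_mul]
          exact mul_le_mul_of_nonneg_left (hg x) (norm_nonneg _)
      _ = (∫ x, ‖T f x‖ ∂μ) * (M + 1) := integral_mul_const _ _
      _ ≤ C * μ.real U * (M + 1) := by gcongr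
  have hlow : (J - 1) * μ.real U ≤ ‖∫ x, f x * A x ∂μ‖ := by
    have h1 : ∫ x, f x * A x ∂μ = ∫ x in U, A x ∂μ := by
      rw [← integral_indicator hU.measurableSet]
      refine integral_congr_ae ?_
      filter_upwards [hf] with x hx
      by_cases hxU : x ∈ U <;> simp [hx, hxU]
    have hAi : Integrable A μ := hgA.continuous_right.integrable_of_hasCompactSupport
      (HasCompactSupport.of_compactSpace A)
    have h2 : ‖∫ x in U, (A x - J) ∂μ‖ ≤ 1 * μ.real U :=
      norm_setIntegral_le_of_norm_le_const (measure_lt_top μ U) fun x hx => le_of_lt hx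
    rw [integral_sub hAi.integrableOn (integrable_const _), setIntegral_const] at h2
    have h3 : ‖μ.real U • (J : ℂ)‖ = J * μ.real U := by
      rw [norm_smul, Real.norm_of_nonneg hpos.le, Complex.norm_natCast, mul_comm]
    have h4 := norm_sub_norm_le (μ.real U • (J : ℂ)) (∫ x in U, A x ∂μ)
    rw [norm_sub_rev, h3] at h4
    rw [h1]
    linarith
  rw [hgA.integral_eq] at hup
  have := hlow.trans hup
  have : (J - 1) * μ.real U ≤ (C * (M + 1)) * μ.real U := by linarith
  have := le_of_mul_le_mul_right this hpos
  linarith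

end GlidingHump

/-! ### Transposed pairs for the Szegő projection -/

theorem not_isBoundedOnL1_szegoProjection (hn : 2 ≤ n) (D : Set (EuclideanSpace ℂ (Fin n)))
    (hD : IsSmoothlyBoundedDomain D) (hb : Bornology.IsBounded D)
    (μ : Measure (frontier D)) [IsSmoothPositiveMeasure (frontier D) μ] :
    ¬ IsBoundedOnL1 (szegoProjection μ) := by
  have hX : IsCompact (frontier D) :=
    Metric.isCompact_of_isClosed_isBounded isClosed_frontier (hb.closure.subset
      frontier_subset_closure)
  have hcs : CompactSpace (frontier D) := isCompact_iff_compactSpace.1 hX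
  have hfin : IsFiniteMeasure μ := inferInstance
  have hnt : Nontrivial (EuclideanSpace ℂ (Fin n)) := by
    have : Nonempty (Fin n) := ⟨⟨0, by omega⟩⟩
    infer_instance
  have hne : (frontier D).Nonempty := by
    refine nonempty_frontier_iff.2 ⟨hD.isConnected.nonempty, ?_⟩
    rintro rfl
    exact NormedSpace.unbounded_univ ℝ _ hb
  obtain ⟨c, hc⟩ := hD.isConnected.nonempty
  have hcX : c ∉ frontier D := fun h => by
    rw [hD.isOpen.frontier_eq] at h
    exact h.2 hc
  obtain ⟨p, hp, h, hh, hhp, hlt⟩ := exists_peak_function hX hne hcX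
  obtain ⟨Z, m, r, hZ, hZp, hm, hr, hadj⟩ :=
    exists_section_formalAdjoint hn hD hb μ ⟨p, hp⟩
  let a := Z.re p
  -- Antilinearity is essential: `ℓ(a) + i ℓ(ia) = 2‖a‖²`, whereas a complex linear form would give
  -- 0. Since `φ p = 0`, this yields `ψ p = -2‖a‖² = κ`.
  let ℓ : EuclideanSpace ℂ (Fin n) →L[ℝ] ℂ :=
    (Complex.conjCLE : ℂ →L[ℝ] ℂ).comp ((innerSL ℂ a).restrictScalars ℝ)
  obtain ⟨M, hM, hφ⟩ := exists_scaled_linear p ℓ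
  obtain ⟨B₁, hB₁⟩ := hX.exists_bound_of_continuousOn Z.contDiff_re.continuous.continuousOn
  obtain ⟨B₂, hB₂⟩ := hX.exists_bound_of_continuousOn Z.contDiff_im.continuous.continuousOn
  obtain ⟨B₃, hB₃⟩ := hX.exists_bound_of_continuousOn hm.continuous.continuousOn
  have hB₁0 := (norm_nonneg _).trans (hB₁ p hp)
  have hB₂0 := (norm_nonneg _).trans (hB₂ p hp)
  have hB₃0 := (norm_nonneg _).trans (hB₃ p hp)
  have ha0 : 0 < ‖a‖ := norm_pos_iff.2 hZp
  let κ : ℝ := -(2 * ‖a‖ ^ 2)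
  have hκ : κ ≠ 0 := neg_ne_zero.2 (by positivity)
  -- The 1 bounds `|h^N|` and the rest bounds `|ψ/κ|`; neither depends on `U` or `ε`.
  refine not_isBoundedOnL1 (p := (⟨p, hp⟩ : frontier D))
    (M := 1 + |κ⁻¹| * (B₃ * M + M * (B₁ + B₂)))
    (fun U hU hpU => measure_pos_of_isOpen hU hpU) (by positivity) fun U hU hpU ε hε => ?_
  obtain ⟨N, hN⟩ := exists_pow_le_of_peak (h := fun x : frontier D => h x)
    (hh.continuous.comp continuous_subtype_val)
    (fun x hx => hlt x x.2 fun hxp => hx (Subtype.ext hxp)) hU hpU hε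
  obtain ⟨δ₀, hδ₀, hδ₀U⟩ := Metric.nhds_basis_closedBall.mem_iff.1 (hU.mem_nhds hpU)
  -- The three bounds give `‖φ‖ ≤ M`, validity of the adjoint formula, and vanishing of `ψ` on `X`
  -- off `U`.
  let δ := min 1 (min r δ₀)
  have hδ : 0 < δ := by positivity
  have hδ1 : δ ≤ 1 := min_le_left _ _
  have hδr : δ ≤ r := (min_le_right _ _).trans (min_le_left _ _)
  have hδU : δ ≤ δ₀ := (min_le_right _ _).trans (min_le_right _ _)
  obtain ⟨φ, hφs, hφt, hφp, hφd, hφb⟩ := hφ δ hδ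
  let ψ : EuclideanSpace ℂ (Fin n) → ℂ := fun x => m x * φ x - Z.apply φ x
  have hψ : ContDiff ℝ ∞ ψ := (hm.mul hφs).sub (contDiff_apply Z hφs)
  have hψa : IsFormalAdjoint μ Z φ ψ :=
    hadj φ hφs (hφt.trans (Metric.closedBall_subset_closedBall hδr))
  have hψb : ∀ x ∈ frontier D, ‖ψ x‖ ≤ B₃ * M + M * (B₁ + B₂) := by
    intro x hx
    have h1 : ‖m x * φ x‖ ≤ B₃ * M := by
      rw [norm_mul]
      refine mul_le_mul (hB₃ x hx) ((hφb x).1.trans ?_) (norm_nonneg _) hB₃0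
      nlinarith
    have h2 : ‖Z.apply φ x‖ ≤ M * (B₁ + B₂) := by
      refine (norm_add_le _ _).trans ?_
      rw [norm_mul, Complex.norm_I, one_mul, mul_add]
      exact add_le_add
        ((ContinuousLinearMap.le_opNorm _ _).trans
          (mul_le_mul (hφb x).2 (hB₁ x hx) (norm_nonneg _) hM))
        ((ContinuousLinearMap.le_opNorm _ _).trans
          (mul_le_mul (hφb x).2 (hB₂ x hx) (norm_nonneg _) hM))
    exact (norm_sub_le _ _).trans (add_le_add h1 h2)
  have hψp : ψ p = κ := by
    have h1 : ℓ a = ((‖a‖ ^ 2 : ℝ) : ℂ) := by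
      simp [ℓ, inner_self_eq_norm_sq_to_K]
    have h2 : ℓ (Complex.I • a) = -Complex.I * ((‖a‖ ^ 2 : ℝ) : ℂ) := by
      simp [ℓ, inner_self_eq_norm_sq_to_K]
    simp only [ψ, ComplexVectorField.apply, hφp, hφd, (hZ p hp).2.2]
    rw [show Z.re p = a from rfl, h1, h2]
    simp only [κ]
    push_cast
    linear_combination (‖a‖ ^ 2 : ℂ) * Complex.I_mul_I
  have hψ0 : ∀ x : frontier D, x ∉ U → ψ x = 0 := by
    intro x hx
    have hx' : (x : EuclideanSpace ℂ (Fin n)) ∉ tsupport φ := fun h' =>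
      hx (hδ₀U (Metric.closedBall_subset_closedBall hδU (hφt h')))
    have h1 : fderiv ℝ φ x = 0 :=
      image_eq_zero_of_notMem_tsupport fun h' => hx' (tsupport_fderiv_subset ℝ h')
    simp [ψ, ComplexVectorField.apply, h1, image_eq_zero_of_notMem_tsupport hx']
  have htest {g : EuclideanSpace ℂ (Fin n) → ℂ} (hg : ContDiff ℝ ∞ g) :
      IsTestFunction (frontier D) g := ⟨hg, HasCompactSupport.of_compactSpace _⟩
  have hcH : Continuous fun x : frontier D => star (h x ^ N) :=
    ((hh.continuous.comp continuous_subtype_val).pow N).star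
  have hcψ : Continuous fun x : frontier D => ψ x := hψ.continuous.comp continuous_subtype_val
  refine ⟨fun x => star (h x ^ N) - (κ⁻¹ : ℝ) * ψ x, fun x => star (h x ^ N),
    ⟨hcH.sub (continuous_const.mul hcψ), hcH, ?_, fun f => ?_⟩, ?_, fun x => ?_, fun x hx => ?_⟩
  · simp [hhp, hψp, hκ]
  · simp only [mul_sub]
    have hi := integrable_Lp_mul_continuous (szegoProjection μ f) hcψ
    have h1 (x : frontier D) : szegoProjection μ f x * (((κ⁻¹ : ℝ) : ℂ) * ψ x) =
        ((κ⁻¹ : ℝ) : ℂ) * (szegoProjection μ f x * ψ x) := by ring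
    simp only [h1]
    rw [integral_sub (integrable_Lp_mul_continuous _ hcH) (hi.const_mul _), integral_const_mul,
      integral_szegoProjection_mul_adjoint f hZ (htest hφs) (htest hψ) hψa, mul_zero, sub_zero]
    exact integral_szegoProjection_mul_conj f (hh.pow N)
  · simp [hhp]
  · refine (norm_sub_le _ _).trans (add_le_add ?_ ?_)
    · rw [norm_star, norm_pow]
      refine pow_le_one₀ (norm_nonneg _) ?_
      by_cases hxp : (x : EuclideanSpace ℂ (Fin n)) = p
      · simp [hxp, hhp]
      · exact (hlt x x.2 hxp).le
    · rw [norm_mul, Complex.norm_real, Real.norm_eq_abs]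
      exact mul_le_mul_of_nonneg_left (hψb x x.2) (abs_nonneg _)
  · simp only [hψ0 x hx]
    rw [mul_zero, sub_zero, norm_star, norm_pow]
    exact hN x hx

end Main

end Szego

theorem mainTheorem7 (n : ℕ) (hn : 2 ≤ n) (D : Set (EuclideanSpace ℂ (Fin n)))
    (hD : Szego.IsSmoothlyBoundedDomain D) (hb : Bornology.IsBounded D)
    (μ : MeasureTheory.Measure (frontier D)) [Szego.IsSmoothPositiveMeasure (frontier D) μ] :
    ¬ Szego.IsBoundedOnL1 (Szego.szegoProjection μ) :=
  Szego.not_isBoundedOnL1_szegoProjection hn D hD hb μ
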